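/- Let $0<\alpha\le 2$ and let $M$ be a symmetric $\alpha$-stable random measure on $\mathbb{R}$ with Lebesgue control measure: an independently scattered, almost surely $\sigma$-additive random set function on the Borel sets of finite Lebesgue measure such that $M(A)$ has characteristic function $\theta\mapsto\exp(-|A|\,|\theta|^{\alpha})$, where $|A|$ is the Lebesgue measure of $A$. Write $M(t)=\int_0^t M(dx)$ for the associated stable Lévy motion ($t\in\mathbb{R}$), so that $M(t)-M(s)=M((s,t])$ almost surely for $s\le t$. For $f\in L^{\alpha}(\mathbb{R})$ let $\int f\,dM$ be the stable stochastic integral, that is, the limit in probability of the integrals of simple functions converging to $f$ in $L^{\alpha}$. The $\alpha$-norm $\|X\|_{\alpha}$ of a symmetric $\alpha$-stable random variable $X$ is its scale parameter, i.e. the unique $\sigma\ge 0$ such that $X$ has characteristic function $\theta\mapsto\exp(-\sigma^{\alpha}|\theta|^{\alpha})$. Let $g:\mathbb{R}\to\mathbb{R}$ be measurable with $\int_{\mathbb{R}}|g|^{\alpha}<\infty$. Suppose that $c_0^+,c_0^-,\gamma,a,c,\eta\in\mathbb{R}$ satisfy $c>0$, $\eta>0$ and $0<\gamma+1/\alpha<a\le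 1$, that $$\frac{g(r)}{r^{\gamma}}\to c_0^+\quad\text{and}\quad \frac{g(-r)}{r^{\gamma}}\to c_0^-\qquad\text{as } r\searrow 0,$$ and that $$|g(u+h)-g(u)|\le c\,|h|^{a}\,|u|^{\gamma-a}\qquad\text{for all } u\in\mathbb{R}\setminus\{0\}\text{ and } |h|<\eta .$$ Let $Y(t)=\int_{\mathbb{R}} g(t-x)\,M(dx)$ for $t\in\mathbb{R}$ and, for $\omega,\Omega\in\mathbb{N}$ with $\omega>0$ and $k\in\mathbb{Z}$, let $$Y_{\omega,\Omega}(k)=\sum_{j=-\omega\Omega+1}^{0} g\Big(\frac{j-1}{\omega}\Big)Z_{\alpha,\omega}(\omega k-j)+\sum_{j=1}^{\omega\Omega} g\Big(\frac{j}{\omega}\Big)Z_{\alpha,\omega}(\omega k-j),\qquad Z_{\alpha,\omega}(j)=M\Big(\frac{j+1}{\omega}\Big)-M\Big(\frac{j}{\omega}\Big).$$ Then, for all $\omega,\Omega\in\mathbb{N}$ with $\omega>1/\eta$ and all $k\in\mathbb{Z}$, the random variable $Y(k)-Y_{\omega,\Omega}(k)$ is symmetric $\alpha$-stable and $$\|Y(k)-Y_{\omega,\Omega}(k)\|_{\alpha}\le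 A_{\omega,\Omega}^{1/\alpha},$$ where $$A_{\omega,\Omega}=\frac{2c^{\alpha}}{(1+a\alpha)\,\omega^{1+\gamma\alpha}}\sum_{j=1}^{\omega\Omega}\frac{1}{j^{(a-\gamma)\alpha}}+\int_{-\infty}^{-\Omega}|g(s)|^{\alpha}\,ds+\int_{\Omega}^{+\infty}|g(s)|^{\alpha}\,ds .$$ -/

import Mathlib

open MeasureTheory ProbabilityTheory Filter Topology
open scoped ENNReal

/-- `HasSymStableLaw α σ P X`: under `P`, the random variable `X` has the symmetric stable law
`S_α(σ, 0, 0)`, that is, the characteristic function `t ↦ exp (-σ^α |t|^α)` with scale `σ ≥ 0`. -/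
structure HasSymStableLaw {S : Type*} [MeasurableSpace S]
    (α σ : ℝ) (P : Measure S) (X : S → ℝ) : Prop where
  aemeasurable : AEMeasurable X P
  scale_nonneg : 0 ≤ σ
  charFun_eq : ∀ t : ℝ, charFun (P.map X) t = ((Real.exp (-(σ ^ α * |t| ^ α)) : ℝ) : ℂ)

/-- The scale parameter is determined by the law. -/
theorem HasSymStableLaw.scale_unique {S : Type*} [MeasurableSpace S] {α σ τ : ℝ}
    {P : Measure S} {X : S → ℝ} (hα : 0 < α)
    (h₁ : HasSymStableLaw α σ P X) (h₂ : HasSymStableLaw α τ P X) : σ = τ := by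
  have h := (h₁.charFun_eq 1).symm.trans (h₂.charFun_eq 1)
  simp only [abs_one, Real.one_rpow, mul_one, Complex.ofReal_inj, Real.exp_eq_exp,
    neg_inj] at h
  exact (Real.rpow_left_inj h₁.scale_nonneg h₂.scale_nonneg hα.ne').1 h

/-- The `α`-norm `‖X‖_α` of a symmetric `α`-stable random variable `X`: its scale parameter
(unique when `X` is symmetric `α`-stable, see `alphaNorm_eq`). -/
noncomputable def alphaNorm {S : Type*} [MeasurableSpace S]
    (α : ℝ) (P : Measure S) (X : S → ℝ) : ℝ :=
  sInf {σ : ℝ | HasSymStableLaw α σ P X}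

theorem alphaNorm_eq {S : Type*} [MeasurableSpace S] {α σ : ℝ}
    {P : Measure S} {X : S → ℝ} (hα : 0 < α) (h : HasSymStableLaw α σ P X) :
    alphaNorm α P X = σ := by
  have hs : {τ : ℝ | HasSymStableLaw α τ P X} = {σ} :=
    Set.eq_singleton_iff_unique_mem.2 ⟨h, fun _ hτ => HasSymStableLaw.scale_unique hα hτ h⟩
  simp [alphaNorm, hs]

/-- `M` is a symmetric `α`-stable random measure on `ℝ` with Lebesgue control measure: an
independently scattered, almost surely `σ`-additive set function, with
`M(A) ~ S_α(|A|^{1/α}, 0, 0)`. Only the values `M A` on Borel sets `A` of finite Lebesgue measure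
are meaningful. The series in `sigma_additive` converges as an ordered series (it need not
converge absolutely when `α ≥ 1`). -/
structure IsSymStableRandomMeasure {S : Type*} [MeasurableSpace S]
    (α : ℝ) (P : Measure S) (M : Set ℝ → S → ℝ) : Prop where
  measurable : ∀ A : Set ℝ, MeasurableSet A → volume A < ∞ → Measurable (M A)
  law : ∀ A : Set ℝ, MeasurableSet A → volume A < ∞ →
    HasSymStableLaw α ((volume A).toReal ^ (1 / α)) P (M A)
  indep : ∀ (n : ℕ) (A : Fin n → Set ℝ), (∀ i, MeasurableSet (A i)) →
    (∀ i, volume (A i) < ∞) → Pairwise (fun i j => Disjoint (A i) (A j)) →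
    iIndepFun (fun i => M (A i)) P
  sigma_additive : ∀ A : ℕ → Set ℝ, (∀ i, MeasurableSet (A i)) →
    Pairwise (fun i j => Disjoint (A i) (A j)) → volume (⋃ i, A i) < ∞ →
    ∀ᵐ s ∂P, Tendsto (fun n : ℕ => ∑ i ∈ Finset.range n, M (A i) s) atTop (𝓝 (M (⋃ i, A i) s))

/-- The integral `∑ c · M(f = c)` of a simple function `f`. For `f` in `L^α` all level sets with
`c ≠ 0` have finite measure, and the term `c = 0` vanishes. -/
noncomputable def simpleStableIntegral {S : Type*}
    (M : Set ℝ → S → ℝ) (f : SimpleFunc ℝ ℝ) (s : S) : ℝ :=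
  ∑ c ∈ f.range, c * M (f ⁻¹' {c}) s

/-- `X` is (a version of) the stable integral `∫ f dM`: the limit in probability of the integrals
of simple functions in `L^α` that converge to `f` in `L^α`. -/
def IsStableIntegral {S : Type*} [MeasurableSpace S]
    (α : ℝ) (P : Measure S) (M : Set ℝ → S → ℝ) (f : ℝ → ℝ) (X : S → ℝ) : Prop :=
  Measurable X ∧ ∃ φ : ℕ → SimpleFunc ℝ ℝ,
    (∀ n, MemLp (φ n) (ENNReal.ofReal α) volume) ∧
    Tendsto (fun n => eLpNorm (fun x => f x - φ n x) (ENNReal.ofReal α) volume) atTop (𝓝 0) ∧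
    TendstoInMeasure P (fun n => simpleStableIntegral M (φ n)) atTop X

open Classical in
/-- The stable stochastic integral `∫ f dM` (with the value `0` if no such limit exists). -/
noncomputable def stableIntegral {S : Type*} [MeasurableSpace S]
    (α : ℝ) (P : Measure S) (M : Set ℝ → S → ℝ) (f : ℝ → ℝ) : S → ℝ :=
  if h : ∃ X : S → ℝ, IsStableIntegral α P M f X then h.choose else 0

/-- The moving average process `Y(t) = ∫ g(t - x) M(dx)`. -/
noncomputable def movingAverage {S : Type*} [MeasurableSpace S]
    (α : ℝ) (P : Measure S) (M : Set ℝ → S → ℝ) (g : ℝ → ℝ) (t : ℝ) : S → ℝ :=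
  stableIntegral α P M (fun x => g (t - x))

/-- The stable Lévy motion `t ↦ ∫_0^t M(dx)` on `ℝ`, whose value at `t` is also written `M(t)`. -/
noncomputable def stableLevyMotion {S : Type*}
    (M : Set ℝ → S → ℝ) (t : ℝ) (s : S) : ℝ :=
  if 0 ≤ t then M (Set.Ioc 0 t) s else -M (Set.Ioc t 0) s

/-- The increment `Z_{α,ω}(j) = M((j+1)/ω) - M(j/ω)`. -/
noncomputable def stableIncrement {S : Type*}
    (M : Set ℝ → S → ℝ) (ω : ℕ) (j : ℤ) (s : S) : ℝ :=
  stableLevyMotion M (((j : ℝ) + 1) / ω) s - stableLevyMotion M ((j : ℝ) / ω) s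

/-- The Riemann sum approximation `Y_{ω,Ω}(k)` with step `1/ω` and cut-off `Ω`. -/
noncomputable def movingAverageApprox {S : Type*}
    (M : Set ℝ → S → ℝ) (g : ℝ → ℝ) (ω Ω : ℕ) (k : ℤ) (s : S) : ℝ :=
  (∑ j ∈ Finset.Icc (-((ω : ℤ) * Ω) + 1) 0,
      g (((j : ℝ) - 1) / ω) * stableIncrement M ω (ω * k - j) s) +
    ∑ j ∈ Finset.Icc (1 : ℤ) ((ω : ℤ) * Ω),
      g ((j : ℝ) / ω) * stableIncrement M ω (ω * k - j) s

/-- The quantity `A_{ω,Ω}` that bounds the `α`-th power of the approximation error. -/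
noncomputable def errorBound (α : ℝ) (g : ℝ → ℝ) (γ a c : ℝ) (ω Ω : ℕ) : ℝ :=
  2 * c ^ α / ((1 + a * α) * (ω : ℝ) ^ (1 + γ * α)) *
      (∑ j ∈ Finset.Icc 1 (ω * Ω), 1 / (j : ℝ) ^ ((a - γ) * α)) +
    (∫ s in Set.Iic (-(Ω : ℝ)), |g s| ^ α) + ∫ s in Set.Ici (Ω : ℝ), |g s| ^ α

/-!
The stable integral is linear and sends `f` to a symmetric stable variable of scale `‖f‖_{L^α}`,
so `‖Y(k) - Y_{ω,Ω}(k)‖_α` is the `L^α` quasi-norm of the difference between `g` and a step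
function. The latter vanishes off `[-Ω, Ω)` and on each cell of length `1 / ω` inside takes the
value of `g` at the endpoint `u = ± m / ω` farther from the origin. As `u ≠ 0`, the Hölder
condition applies there, and integrating `c ^ α |u| ^ ((γ - a) α) |s - u| ^ (a α)` over the cell
gives the `m`-th term of the sum; each `m ≥ 1` occurs twice, once on each side of the origin. The
two integrals in `A_{ω,Ω}` are the tails of `g`.
-/

section LpQuasiNorm

variable {X E : Type*} [MeasurableSpace X] {μ : Measure X} [NormedAddCommGroup E] {α : ℝ}
  {f g : X → E}

theorem eLpNorm_ofReal_rpow (hα : 0 < α) (f : X → E) :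
    eLpNorm f (ENNReal.ofReal α) μ ^ α = ∫⁻ x, ‖f x‖ₑ ^ α ∂μ := by
  rw [eLpNorm_eq_lintegral_rpow_enorm_toReal (by simpa using hα) ENNReal.ofReal_ne_top,
    ENNReal.toReal_ofReal hα.le, ← ENNReal.rpow_mul, one_div_mul_cancel hα.ne', ENNReal.rpow_one]

theorem eLpNorm_simpleFunc_rpow (hα : 0 < α) (φ : SimpleFunc X E) :
    eLpNorm φ (ENNReal.ofReal α) μ ^ α = ∑ c ∈ φ.range, ‖c‖ₑ ^ α * μ (φ ⁻¹' {c}) := by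
  rw [eLpNorm_ofReal_rpow hα, ← SimpleFunc.map_lintegral, ← SimpleFunc.lintegral_eq_lintegral]
  rfl

/-- For `α < 1` the `L^α` norm is not subadditive, but its `α`-th power is. -/
theorem eLpNorm_add_rpow_min_le (hα : 0 < α) (hf : AEStronglyMeasurable f μ)
    (hg : AEStronglyMeasurable g μ) :
    eLpNorm (f + g) (ENNReal.ofReal α) μ ^ min 1 α ≤
      eLpNorm f (ENNReal.ofReal α) μ ^ min 1 α + eLpNorm g (ENNReal.ofReal α) μ ^ min 1 α := by
  rcases le_total 1 α with h | h
  · simpa only [min_eq_left h, ENNReal.rpow_one] using eLpNorm_add_le hf hg (by simpa using h)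
  · simp only [min_eq_right h, eLpNorm_ofReal_rpow hα]
    rw [← lintegral_add_left' (hf.enorm.pow_const α)]
    refine lintegral_mono fun x => ?_
    calc ‖(f + g) x‖ₑ ^ α ≤ (‖f x‖ₑ + ‖g x‖ₑ) ^ α := by
          gcongr; exact enorm_add_le _ _
      _ ≤ ‖f x‖ₑ ^ α + ‖g x‖ₑ ^ α := ENNReal.rpow_add_le_add_rpow _ _ hα.le h

variable {ι : Type*} {l : Filter ι} {φ : ι → X → E}

theorem tendsto_eLpNorm_of_tendsto_eLpNorm_sub (hα : 0 < α) (hf : MemLp f (ENNReal.ofReal α) μ)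
    (hφ : ∀ i, AEStronglyMeasurable (φ i) μ)
    (h : Tendsto (fun i => eLpNorm (f - φ i) (ENNReal.ofReal α) μ) l (𝓝 0)) :
    Tendsto (fun i => eLpNorm (φ i) (ENNReal.ofReal α) μ) l
      (𝓝 (eLpNorm f (ENNReal.ofReal α) μ)) := by
  set q := min 1 α
  have hq : 0 < q := lt_min one_pos hα
  let N : (X → E) → ℝ≥0∞ := fun u => eLpNorm u (ENNReal.ofReal α) μ ^ q
  have hNsub : Tendsto (fun i => N (f - φ i)) l (𝓝 0) := by
    simpa [N, hq] using h.ennrpow_const q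
  have hNf : N f ≠ ∞ := ENNReal.rpow_ne_top_of_nonneg hq.le hf.eLpNorm_ne_top
  have hN : Tendsto (fun i => N (φ i)) l (𝓝 (N f)) := by
    refine tendsto_of_tendsto_of_tendsto_of_le_of_le
      (g := fun i => N f - N (f - φ i)) (h := fun i => N f + N (f - φ i))
      (by simpa using ENNReal.Tendsto.sub tendsto_const_nhds hNsub (Or.inl hNf))
      (by simpa using tendsto_const_nhds.add hNsub) (fun i => ?_) (fun i => ?_)
    · have := eLpNorm_add_rpow_min_le hα (hφ i) (hf.1.sub (hφ i))
      rw [add_sub_cancel] at this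
      exact tsub_le_iff_right.2 this
    · have := eLpNorm_add_rpow_min_le hα hf.1 ((hφ i).sub hf.1)
      rwa [add_sub_cancel, eLpNorm_sub_comm] at this
  simpa [N, ← ENNReal.rpow_mul, mul_inv_cancel₀ hq.ne'] using hN.ennrpow_const q⁻¹

theorem tendsto_eLpNorm_sub_sub {p : ℝ≥0∞} {φ : ℕ → X → E} (hf : AEStronglyMeasurable f μ)
    (hφ : ∀ n, AEStronglyMeasurable (φ n) μ)
    (h : Tendsto (fun n => eLpNorm (f - φ n) p μ) atTop (𝓝 0)) :
    Tendsto (fun mn : ℕ × ℕ => eLpNorm (φ mn.1 - φ mn.2) p μ) atTop (𝓝 0) := by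
  rw [← prod_atTop_atTop_eq]
  have hsum : Tendsto (fun mn : ℕ × ℕ => ENNReal.LpAddConst p *
      (eLpNorm (f - φ mn.2) p μ + eLpNorm (f - φ mn.1) p μ)) (atTop ×ˢ atTop) (𝓝 0) := by
    simpa using ENNReal.Tendsto.const_mul ((h.comp tendsto_snd).add (h.comp tendsto_fst))
      (Or.inr (ENNReal.LpAddConst_lt_top p).ne)
  refine tendsto_of_tendsto_of_tendsto_of_le_of_le tendsto_const_nhds hsum
    (fun _ => zero_le) fun mn => ?_
  have := eLpNorm_add_le' (hf.sub (hφ mn.2)) ((hφ mn.1).sub hf) p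
  rwa [add_comm (f - _), sub_add_sub_cancel, eLpNorm_sub_comm (φ mn.1) f] at this

theorem simpleFunc_coe_sum {ι : Type*} (T : Finset ι) (φ : ι → SimpleFunc X E) :
    ⇑(∑ i ∈ T, φ i) = ∑ i ∈ T, ⇑(φ i) := by
  classical
  induction T using Finset.induction_on with
  | empty => simp
  | insert i T hi ih => simp [Finset.sum_insert hi, ih]

theorem memLp_simpleFunc_sum {ι : Type*} {T : Finset ι} {p : ℝ≥0∞} {φ : ι → SimpleFunc X E}
    (hφ : ∀ i ∈ T, MemLp (φ i) p μ) : MemLp (∑ i ∈ T, φ i : SimpleFunc X E) p μ := by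
  rw [simpleFunc_coe_sum]
  exact memLp_finsetSum' T hφ

theorem memLp_const_restrict {p : ℝ≥0∞} (c : E) {A : Set X} (hA : MeasurableSet A)
    (hv : μ A ≠ ∞) : MemLp ((SimpleFunc.const X c).restrict A) p μ := by
  rw [SimpleFunc.coe_restrict _ hA]
  exact memLp_indicator_const p hA c (Or.inr hv)

end LpQuasiNorm

theorem exists_subseq_tendsto_ae_of_cauchy {S E : Type*} [MeasurableSpace S] {μ : Measure S}
    [NormedAddCommGroup E] [CompleteSpace E] [MeasurableSpace E] [BorelSpace E]
    {X : ℕ → S → E} (hX : ∀ n, AEMeasurable (X n) μ)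
    (h : TendstoInMeasure μ (fun mn : ℕ × ℕ => X mn.1 - X mn.2) atTop 0) :
    ∃ (ns : ℕ → ℕ) (Y : S → E), StrictMono ns ∧ Measurable Y ∧
      ∀ᵐ s ∂μ, Tendsto (fun n => X (ns n) s) atTop (𝓝 (Y s)) := by
  have hsmall (n : ℕ) : ∃ k, ∀ i ≥ k, ∀ j ≥ k,
      μ {s | (1 / 2 : ℝ) ^ n ≤ ‖X i s - X j s‖} ≤ 2⁻¹ ^ n := by
    obtain ⟨k, hk⟩ := eventually_atTop_prod_self'.1 <| ENNReal.tendsto_nhds_zero.1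
      (tendstoInMeasure_iff_norm.1 h ((1 / 2) ^ n) (by positivity)) (2⁻¹ ^ n)
      (ENNReal.pow_pos (by simp) n)
    exact ⟨k, fun i hi j hj => by simpa using hk i hi j hj⟩
  obtain ⟨ns, hns, hk⟩ := extraction_forall_of_eventually'
    (P := fun n k => ∀ i ≥ k, ∀ j ≥ k, μ {s | (1 / 2 : ℝ) ^ n ≤ ‖X i s - X j s‖} ≤ 2⁻¹ ^ n)
    fun n => (hsmall n).imp fun k hk l hl i hi j hj => hk i (hl.trans hi) j (hl.trans hj)
  have hBC : ∀ᵐ s ∂μ, ∀ᶠ n in atTop,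
      s ∉ {s | (1 / 2 : ℝ) ^ n ≤ ‖X (ns n) s - X (ns (n + 1)) s‖} := by
    refine ae_eventually_notMem (ne_top_of_le_ne_top ?_
      (ENNReal.tsum_le_tsum fun n => hk n _ le_rfl _ (hns.monotone n.le_succ)))
    simp [ENNReal.tsum_geometric]
  have hlim : ∀ᵐ s ∂μ, ∃ y, Tendsto (fun n => X (ns n) s) atTop (𝓝 y) := by
    filter_upwards [hBC] with s hs
    obtain ⟨N, hN⟩ := eventually_atTop.1 hs
    have hcauchy : CauchySeq fun n => X (ns (n + N)) s := by
      refine cauchySeq_of_le_geometric (1 / 2) 1 (by norm_num) fun n => ?_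
      have hlt := not_le.1 (hN (n + N) (Nat.le_add_left N n))
      rw [dist_eq_norm, one_mul, Nat.add_right_comm]
      exact hlt.le.trans (pow_le_pow_of_le_one (by norm_num) (by norm_num) (Nat.le_add_right n N))
    exact (cauchySeq_tendsto_of_complete hcauchy).imp
      fun y hy => (tendsto_add_atTop_iff_nat N).1 hy
  obtain ⟨Y, hY, hXY⟩ := measurable_limit_of_tendsto_metrizable_ae (fun n => hX (ns n)) hlim
  exact ⟨ns, Y, hns, hY, hXY⟩

namespace HasSymStableLaw

variable {S : Type*} [MeasurableSpace S] {P : Measure S} {α σ : ℝ} {X Y : S → ℝ}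

theorem congr_ae (h : HasSymStableLaw α σ P X) (hXY : X =ᵐ[P] Y) : HasSymStableLaw α σ P Y where
  aemeasurable := h.aemeasurable.congr hXY
  scale_nonneg := h.scale_nonneg
  charFun_eq t := by rw [← Measure.map_congr hXY]; exact h.charFun_eq t

theorem const_mul (h : HasSymStableLaw α σ P X) (w : ℝ) :
    HasSymStableLaw α (|w| * σ) P (fun s => w * X s) where
  aemeasurable := h.aemeasurable.const_mul w
  scale_nonneg := mul_nonneg (abs_nonneg w) h.scale_nonneg
  charFun_eq t := by
    rw [charFun_map_mul_comp h.aemeasurable, h.charFun_eq, abs_mul,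
      Real.mul_rpow (abs_nonneg w) (abs_nonneg t),
      Real.mul_rpow (abs_nonneg w) h.scale_nonneg]
    congr 3
    ring

theorem sum (hα : 0 < α) {ι : Type*} [Fintype ι] {σ : ι → ℝ} {X : ι → S → ℝ}
    (hX : ∀ i, HasSymStableLaw α (σ i) P (X i)) (hind : iIndepFun X P) :
    HasSymStableLaw α ((∑ i, σ i ^ α) ^ (1 / α)) P (fun s => ∑ i, X i s) where
  aemeasurable := Finset.aemeasurable_fun_sum _ fun i _ => (hX i).aemeasurable
  scale_nonneg :=
    Real.rpow_nonneg (Finset.sum_nonneg fun i _ => Real.rpow_nonneg (hX i).scale_nonneg α) _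
  charFun_eq t := by
    rw [hind.charFun_map_fun_sum_eq_prod fun i => (hX i).aemeasurable, Finset.prod_apply,
      ← Real.rpow_mul (Finset.sum_nonneg fun i _ => Real.rpow_nonneg (hX i).scale_nonneg α),
      one_div_mul_cancel hα.ne', Real.rpow_one, Finset.sum_mul, ← Finset.sum_neg_distrib,
      Real.exp_sum, Complex.ofReal_prod]
    exact Finset.prod_congr rfl fun i _ => (hX i).charFun_eq t

variable [IsProbabilityMeasure P]

theorem ae_eq_zero (hα : 0 < α) (h : HasSymStableLaw α 0 P X) : X =ᵐ[P] 0 := by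
  have := Measure.isProbabilityMeasure_map h.aemeasurable
  have hdirac : P.map X = Measure.dirac 0 := by
    refine Measure.ext_of_charFun (funext fun t => ?_)
    simp [h.charFun_eq, charFun_dirac, Real.zero_rpow hα.ne']
  have hzero : ∀ᵐ x ∂(P.map X), x = 0 := by simp [hdirac]
  exact ae_of_ae_map h.aemeasurable hzero

theorem measureReal_lt_abs_le (hα : 0 < α) (h : HasSymStableLaw α σ P X) {ε : ℝ} (hε : 0 < ε) :
    P.real {s | ε < |X s|} ≤ 2 * (σ * (2 * ε⁻¹)) ^ α := by
  have := Measure.isProbabilityMeasure_map h.aemeasurable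
  have hσ := h.scale_nonneg
  have hdefect : ‖∫ t in (-2 * ε⁻¹)..(2 * ε⁻¹), 1 - charFun (P.map X) t‖ ≤
      (σ * (2 * ε⁻¹)) ^ α * |2 * ε⁻¹ - -2 * ε⁻¹| := by
    refine intervalIntegral.norm_integral_le_of_norm_le_const fun t ht => ?_
    rw [Set.uIoc_of_le (by nlinarith [inv_pos.2 hε])] at ht
    have ht' : |t| ≤ 2 * ε⁻¹ := abs_le.2 ⟨by linarith [ht.1], ht.2⟩
    have hx : 0 ≤ σ ^ α * |t| ^ α := by positivity
    rw [h.charFun_eq, ← Complex.ofReal_one, ← Complex.ofReal_sub, Complex.norm_real,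
      Real.norm_eq_abs, abs_of_nonneg (by simpa using hx)]
    calc 1 - Real.exp (-(σ ^ α * |t| ^ α)) ≤ σ ^ α * |t| ^ α := by
          linarith [Real.add_one_le_exp (-(σ ^ α * |t| ^ α))]
      _ ≤ σ ^ α * (2 * ε⁻¹) ^ α := by gcongr
      _ = (σ * (2 * ε⁻¹)) ^ α := (Real.mul_rpow hσ (by positivity)).symm
  calc P.real {s | ε < |X s|} = (P.map X).real {x | ε < |x|} :=
        (map_measureReal_apply_of_aemeasurable h.aemeasurable
          (measurableSet_lt measurable_const measurable_norm)).symm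
    _ ≤ 2⁻¹ * ε * ‖∫ t in (-2 * ε⁻¹)..(2 * ε⁻¹), 1 - charFun (P.map X) t‖ :=
        measureReal_abs_gt_le_integral_charFun hε
    _ ≤ 2⁻¹ * ε * ((σ * (2 * ε⁻¹)) ^ α * |2 * ε⁻¹ - -2 * ε⁻¹|) := by gcongr
    _ = 2 * (σ * (2 * ε⁻¹)) ^ α := by
        rw [abs_of_nonneg (by have := inv_pos.2 hε; linarith)]
        field_simp
        ring

theorem tendstoInMeasure_zero (hα : 0 < α) {ι : Type*} {l : Filter ι} {τ : ι → ℝ}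
    {Z : ι → S → ℝ} (hZ : ∀ i, HasSymStableLaw α (τ i) P (Z i))
    (hτ : Tendsto τ l (𝓝 0)) : TendstoInMeasure P Z l 0 := by
  refine tendstoInMeasure_iff_measureReal_norm.2 fun ε hε => ?_
  have hbound : Tendsto (fun i => 2 * (τ i * (2 * (ε / 2)⁻¹)) ^ α) l (𝓝 0) := by
    have hcont : Continuous fun x : ℝ => 2 * (x * (2 * (ε / 2)⁻¹)) ^ α := by
      have := Real.continuous_rpow_const hα.le
      fun_prop
    simpa [Function.comp_def, hα.ne'] using (hcont.tendsto 0).comp hτ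
  refine squeeze_zero (fun _ => measureReal_nonneg) (fun i => ?_) hbound
  refine le_trans (measureReal_mono fun s hs => ?_)
    ((hZ i).measureReal_lt_abs_le hα (half_pos hε))
  simp only [Pi.zero_apply, sub_zero, Real.norm_eq_abs, Set.mem_ofPred_eq] at hs ⊢
  exact (half_lt_self hε).trans_le hs

theorem of_tendstoInMeasure (hα : 0 < α) {τ : ℕ → ℝ} {Z : ℕ → S → ℝ}
    (hZ : ∀ n, HasSymStableLaw α (τ n) P (Z n)) (hZX : TendstoInMeasure P Z atTop X)
    (hτ : Tendsto τ atTop (𝓝 σ)) : HasSymStableLaw α σ P X where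
  aemeasurable := hZX.aemeasurable fun n => (hZ n).aemeasurable
  scale_nonneg := ge_of_tendsto' hτ fun n => (hZ n).scale_nonneg
  charFun_eq t := by
    have hlaws := (hZX.tendstoInDistribution fun n => (hZ n).aemeasurable).tendsto
    have hchar := ProbabilityMeasure.tendsto_iff_tendsto_charFun.1 hlaws t
    simp only [ProbabilityMeasure.coe_mk, (hZ _).charFun_eq] at hchar
    have hcont : Continuous fun x : ℝ => ((Real.exp (-(x ^ α * |t| ^ α)) : ℝ) : ℂ) := by
      have := Real.continuous_rpow_const hα.le
      fun_prop
    exact tendsto_nhds_unique hchar ((hcont.tendsto σ).comp hτ)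

end HasSymStableLaw

namespace IsSymStableRandomMeasure

variable {S : Type*} [MeasurableSpace S] {P : Measure S} {α : ℝ} {M : Set ℝ → S → ℝ}

theorem iIndepFun_of_pairwise_disjoint (hM : IsSymStableRandomMeasure α P M) {ι : Type*}
    [Finite ι] {A : ι → Set ℝ} (hA : ∀ i, MeasurableSet (A i)) (hv : ∀ i, volume (A i) < ∞)
    (hd : Pairwise fun i j => Disjoint (A i) (A j)) : iIndepFun (fun i => M (A i)) P := by
  let e := Finite.equivFin ι
  have h := (hM.indep _ (A ∘ e.symm) (fun i => hA _) (fun i => hv _)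
    fun i j hij => hd (e.symm.injective.ne hij)).precomp e.injective
  simpa [Function.comp_def] using h

theorem hasSymStableLaw_sum_mul (hM : IsSymStableRandomMeasure α P M) (hα : 0 < α) {ι : Type*}
    [Fintype ι] (w : ι → ℝ) {A : ι → Set ℝ} (hA : ∀ i, MeasurableSet (A i))
    (hv : ∀ i, volume (A i) < ∞) (hd : Pairwise fun i j => Disjoint (A i) (A j)) :
    HasSymStableLaw α ((∑ i, |w i| ^ α * (volume (A i)).toReal) ^ (1 / α)) P
      (fun s => ∑ i, w i * M (A i) s) := by
  have hscale (i : ι) : (|w i| * (volume (A i)).toReal ^ (1 / α)) ^ α =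
      |w i| ^ α * (volume (A i)).toReal := by
    rw [Real.mul_rpow (abs_nonneg _) (Real.rpow_nonneg ENNReal.toReal_nonneg _),
      ← Real.rpow_mul ENNReal.toReal_nonneg, one_div_mul_cancel hα.ne', Real.rpow_one]
  simpa only [hscale] using HasSymStableLaw.sum hα
    (fun i => (hM.law (A i) (hA i) (hv i)).const_mul (w i))
    ((hM.iIndepFun_of_pairwise_disjoint hA hv hd).comp (fun i x => w i * x)
      fun i => measurable_const_mul _)

theorem measurable_simpleStableIntegral (hM : IsSymStableRandomMeasure α P M) (hα : 0 < α)
    {φ : SimpleFunc ℝ ℝ} (hφ : MemLp φ (ENNReal.ofReal α) volume) :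
    Measurable (simpleStableIntegral M φ) := by
  have hfin := SimpleFunc.measure_preimage_lt_top_of_memLp (by simpa using hα) (by simp) _ hφ
  refine Finset.measurable_fun_sum _ fun c _ => ?_
  rcases eq_or_ne c 0 with rfl | hc
  · simp
  · exact (hM.measurable _ (φ.measurableSet_preimage _) (hfin c hc)).const_mul c

theorem hasSymStableLaw_simpleStableIntegral (hM : IsSymStableRandomMeasure α P M) (hα : 0 < α)
    {φ : SimpleFunc ℝ ℝ} (hφ : MemLp φ (ENNReal.ofReal α) volume) :
    HasSymStableLaw α (eLpNorm φ (ENNReal.ofReal α) volume).toReal P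
      (simpleStableIntegral M φ) := by
  have hfin := SimpleFunc.measure_preimage_lt_top_of_memLp (by simpa using hα) (by simp) _ hφ
  have hlaw := hM.hasSymStableLaw_sum_mul hα (fun c : φ.range.erase 0 => (c : ℝ))
    (A := fun c => φ ⁻¹' {(c : ℝ)}) (fun c => φ.measurableSet_preimage _)
    (fun c => hfin c (Finset.ne_of_mem_erase c.2))
    fun c d hcd => (Set.disjoint_singleton.2 (Subtype.coe_injective.ne hcd)).preimage _
  have hnorm : (eLpNorm φ (ENNReal.ofReal α) volume).toReal ^ α =
      ∑ c : φ.range.erase 0, |(c : ℝ)| ^ α * (volume (φ ⁻¹' {(c : ℝ)})).toReal := by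
    rw [ENNReal.toReal_rpow, eLpNorm_simpleFunc_rpow hα,
      ← Finset.sum_erase (a := 0) _ (by simp [hα]), ← Finset.sum_coe_sort, ENNReal.toReal_sum]
    · simp [← ENNReal.toReal_rpow]
    · exact fun c _ => ENNReal.mul_ne_top (ENNReal.rpow_ne_top_of_nonneg hα.le enorm_ne_top)
        (hfin c (Finset.ne_of_mem_erase c.2)).ne
  have hint : simpleStableIntegral M φ =
      fun s => ∑ c : φ.range.erase 0, (c : ℝ) * M (φ ⁻¹' {(c : ℝ)}) s := by
    ext s
    rw [Finset.sum_coe_sort (φ.range.erase 0) fun c => c * M (φ ⁻¹' {c}) s,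
      Finset.sum_erase _ (zero_mul _), simpleStableIntegral]
  rwa [← hnorm, ← Real.rpow_mul ENNReal.toReal_nonneg, mul_one_div_cancel hα.ne', Real.rpow_one,
    ← hint] at hlaw

variable [IsProbabilityMeasure P]

theorem ae_empty (hM : IsSymStableRandomMeasure α P M) (hα : 0 < α) : M ∅ =ᵐ[P] 0 := by
  have h := hM.law ∅ MeasurableSet.empty (by simp)
  rw [measure_empty, ENNReal.toReal_zero, Real.zero_rpow (by positivity)] at h
  exact h.ae_eq_zero hα

theorem ae_union (hM : IsSymStableRandomMeasure α P M) (hα : 0 < α) {A B : Set ℝ}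
    (hA : MeasurableSet A) (hB : MeasurableSet B) (hAB : Disjoint A B)
    (hAv : volume A < ∞) (hBv : volume B < ∞) : M (A ∪ B) =ᵐ[P] M A + M B := by
  let C : ℕ → Set ℝ
    | 0 => A
    | 1 => B
    | _ + 2 => ∅
  have hU : ⋃ i, C i = A ∪ B := by
    rw [← Set.union_iUnion_nat_succ, ← Set.union_iUnion_nat_succ fun i => C (i + 1)]
    simp [C]
  have hm : ∀ i, MeasurableSet (C i)
    | 0 => hA
    | 1 => hB
    | _ + 2 => MeasurableSet.empty
  have hd : Pairwise fun i j => Disjoint (C i) (C j)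
    | 0, 1, _ => hAB
    | 1, 0, _ => hAB.symm
    | _ + 2, _, _ => Set.empty_disjoint _
    | _, _ + 2, _ => Set.disjoint_empty _
  have hlim := hM.sigma_additive C hm hd (by
    rw [hU]; exact (measure_union_le A B).trans_lt (ENNReal.add_lt_top.2 ⟨hAv, hBv⟩))
  rw [hU] at hlim
  filter_upwards [hlim, hM.ae_empty hα] with s hs h0
  refine tendsto_nhds_unique ((tendsto_add_atTop_iff_nat 2).2 hs)
    (tendsto_const_nhds.congr fun n => ?_)
  simp [Finset.sum_range_succ', C, h0, add_comm]

theorem ae_biUnion (hM : IsSymStableRandomMeasure α P M) (hα : 0 < α) {ι : Type*}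
    {T : Finset ι} {A : ι → Set ℝ} (hA : ∀ i ∈ T, MeasurableSet (A i))
    (hd : (T : Set ι).PairwiseDisjoint A) (hv : ∀ i ∈ T, volume (A i) < ∞) :
    M (⋃ i ∈ T, A i) =ᵐ[P] ∑ i ∈ T, M (A i) := by
  classical
  induction T using Finset.induction_on with
  | empty => simpa using hM.ae_empty hα
  | insert i T hi ih =>
    rw [Finset.forall_mem_insert] at hA hv
    rw [Finset.coe_insert, Set.pairwiseDisjoint_insert_of_notMem (by simpa using hi)] at hd
    rw [Finset.set_biUnion_insert, Finset.sum_insert hi]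
    exact (hM.ae_union hα hA.1 (Finset.measurableSet_biUnion _ hA.2)
      (Set.disjoint_iUnion₂_right.2 hd.2) hv.1
      (measure_biUnion_lt_top T.finite_toSet hv.2)).trans
      ((ae_eq_refl _).add (ih hA.2 hd.1 hv.2))

theorem simpleStableIntegral_map (hM : IsSymStableRandomMeasure α P M) (hα : 0 < α) {β : Type*}
    {χ : SimpleFunc ℝ β} {h : β → ℝ} (hχ : MemLp (χ.map h) (ENNReal.ofReal α) volume) :
    simpleStableIntegral M (χ.map h) =ᵐ[P]
      fun s => ∑ b ∈ χ.range, h b * M (χ ⁻¹' {b}) s := by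
  classical
  have hfin := SimpleFunc.measure_preimage_lt_top_of_memLp (by simpa using hα) (by simp) _ hχ
  have hlevel : ∀ c ∈ (χ.map h).range, ∀ᵐ s ∂P,
      c * M (χ.map h ⁻¹' {c}) s = ∑ b ∈ χ.range with h b = c, h b * M (χ ⁻¹' {b}) s := by
    intro c _
    rcases eq_or_ne c 0 with rfl | hc
    · refine ae_of_all _ fun s => ?_
      rw [zero_mul, Finset.sum_eq_zero]
      intro b hb
      rw [(Finset.mem_filter.1 hb).2, zero_mul]
    · have hU : χ.map h ⁻¹' {c} = ⋃ b ∈ χ.range.filter (h · = c), χ ⁻¹' {b} := by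
        ext x; simp
      have hsplit := hM.ae_biUnion hα (T := χ.range.filter (h · = c)) (A := fun b => χ ⁻¹' {b})
        (fun b _ => χ.measurableSet_preimage _)
        (fun b _ b' _ hbb' => (Set.disjoint_singleton.2 hbb').preimage _)
        (fun b hb => (measure_mono (hU ▸ Set.subset_biUnion_of_mem (u := fun b => χ ⁻¹' {b})
          hb)).trans_lt (hfin c hc))
      rw [← hU] at hsplit
      filter_upwards [hsplit] with s hs
      rw [hs, Finset.sum_apply, Finset.mul_sum]
      exact Finset.sum_congr rfl fun b hb => by rw [(Finset.mem_filter.1 hb).2]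
  filter_upwards [(ae_ball_iff (Finset.countable_toSet _)).2 hlevel] with s hs
  rw [simpleStableIntegral, Finset.sum_congr rfl hs, SimpleFunc.range_map]
  exact Finset.sum_fiberwise_of_maps_to (fun b hb => Finset.mem_image_of_mem _ hb) _

variable {φ ψ : SimpleFunc ℝ ℝ}

theorem simpleStableIntegral_add (hM : IsSymStableRandomMeasure α P M) (hα : 0 < α)
    (hφ : MemLp φ (ENNReal.ofReal α) volume) (hψ : MemLp ψ (ENNReal.ofReal α) volume) :
    simpleStableIntegral M (φ + ψ) =ᵐ[P] simpleStableIntegral M φ + simpleStableIntegral M ψ := by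
  have hfst := hM.simpleStableIntegral_map hα (χ := φ.pair ψ) (h := Prod.fst) hφ
  have hsnd := hM.simpleStableIntegral_map hα (χ := φ.pair ψ) (h := Prod.snd) hψ
  have hadd := hM.simpleStableIntegral_map hα (χ := φ.pair ψ) (h := fun p => p.1 + p.2)
    (hφ.add hψ)
  rw [SimpleFunc.map_fst_pair] at hfst
  rw [SimpleFunc.map_snd_pair] at hsnd
  rw [← SimpleFunc.add_eq_map₂] at hadd
  filter_upwards [hfst, hsnd, hadd] with s hfst hsnd hadd
  rw [hadd, Pi.add_apply, hfst, hsnd, ← Finset.sum_add_distrib]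
  exact Finset.sum_congr rfl fun _ _ => add_mul _ _ _

theorem simpleStableIntegral_sub (hM : IsSymStableRandomMeasure α P M) (hα : 0 < α)
    (hφ : MemLp φ (ENNReal.ofReal α) volume) (hψ : MemLp ψ (ENNReal.ofReal α) volume) :
    simpleStableIntegral M (φ - ψ) =ᵐ[P] simpleStableIntegral M φ - simpleStableIntegral M ψ := by
  have h := hM.simpleStableIntegral_add hα (φ := φ - ψ) (hφ.sub hψ) hψ
  rw [show φ - ψ + ψ = φ by ext; simp] at h
  filter_upwards [h] with s hs
  rw [Pi.sub_apply, hs, Pi.add_apply, add_sub_cancel_right]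

theorem simpleStableIntegral_sum (hM : IsSymStableRandomMeasure α P M) (hα : 0 < α) {ι : Type*}
    (T : Finset ι) {φ : ι → SimpleFunc ℝ ℝ}
    (hφ : ∀ i ∈ T, MemLp (φ i) (ENNReal.ofReal α) volume) :
    simpleStableIntegral M (∑ i ∈ T, φ i) =ᵐ[P] ∑ i ∈ T, simpleStableIntegral M (φ i) := by
  classical
  induction T using Finset.induction_on with
  | empty =>
    refine ae_of_all _ fun s => Finset.sum_eq_zero fun c hc => ?_
    obtain ⟨x, rfl⟩ := SimpleFunc.mem_range.1 hc
    simp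
  | insert i T hi ih =>
    rw [Finset.forall_mem_insert] at hφ
    rw [Finset.sum_insert hi, Finset.sum_insert hi]
    exact (hM.simpleStableIntegral_add hα hφ.1 (memLp_simpleFunc_sum hφ.2)).trans
      ((ae_eq_refl _).add (ih hφ.2))

theorem simpleStableIntegral_const_restrict (hM : IsSymStableRandomMeasure α P M) (hα : 0 < α)
    (r : ℝ) {A : Set ℝ} (hA : MeasurableSet A) :
    simpleStableIntegral M ((SimpleFunc.const ℝ r).restrict A) =ᵐ[P] fun s => r * M A s := by
  filter_upwards [hM.ae_empty hα] with s h0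
  calc simpleStableIntegral M ((SimpleFunc.const ℝ r).restrict A) s
      = r * M ((SimpleFunc.const ℝ r).restrict A ⁻¹' {r}) s := by
        refine Finset.sum_eq_single r (fun c hc hcr => ?_) fun hr => ?_
        · obtain ⟨x, rfl⟩ := SimpleFunc.mem_range.1 hc
          by_cases hx : x ∈ A <;> simp_all [SimpleFunc.restrict_apply]
        · rw [(SimpleFunc.preimage_eq_empty_iff _ _).2 hr, h0, Pi.zero_apply, mul_zero]
    _ = r * M A s := by
        rcases eq_or_ne r 0 with rfl | hr
        · simp
        · rw [SimpleFunc.restrict_preimage_singleton _ hA hr,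
            show SimpleFunc.const ℝ r ⁻¹' {r} = Set.univ by ext; simp, Set.inter_univ]

theorem simpleStableIntegral_sum_const_restrict (hM : IsSymStableRandomMeasure α P M)
    (hα : 0 < α) {ι : Type*} (T : Finset ι) (r : ι → ℝ) {A : ι → Set ℝ}
    (hA : ∀ i ∈ T, MeasurableSet (A i)) (hv : ∀ i ∈ T, volume (A i) < ∞) :
    simpleStableIntegral M (∑ i ∈ T, (SimpleFunc.const ℝ (r i)).restrict (A i)) =ᵐ[P]
      fun s => ∑ i ∈ T, r i * M (A i) s := by
  have hterm := (ae_ball_iff T.countable_toSet).2 fun i hi =>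
    hM.simpleStableIntegral_const_restrict hα (r i) (hA i hi)
  filter_upwards [hM.simpleStableIntegral_sum hα T fun i hi =>
    memLp_const_restrict _ (hA i hi) (hv i hi).ne, hterm] with s hsum hterm
  rw [hsum, Finset.sum_apply]
  exact Finset.sum_congr rfl hterm

theorem stableLevyMotion_sub (hM : IsSymStableRandomMeasure α P M) (hα : 0 < α) {x y : ℝ}
    (hxy : x ≤ y) : stableLevyMotion M y - stableLevyMotion M x =ᵐ[P] M (Set.Ioc x y) := by
  have hsplit {a b c : ℝ} (hab : a ≤ b) (hbc : b ≤ c) :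
      M (Set.Ioc a c) =ᵐ[P] M (Set.Ioc a b) + M (Set.Ioc b c) := by
    rw [← Set.Ioc_union_Ioc_eq_Ioc hab hbc]
    exact hM.ae_union hα measurableSet_Ioc measurableSet_Ioc
      (Set.Ioc_disjoint_Ioc_of_le le_rfl) (by simp) (by simp)
  rcases le_or_gt 0 x with hx | hx
  · filter_upwards [hsplit hx hxy] with s hs
    simp [stableLevyMotion, hx, hx.trans hxy, hs]
  rcases le_or_gt 0 y with hy | hy
  · filter_upwards [hsplit hx.le hy] with s hs
    simp [stableLevyMotion, hx.not_ge, hy, hs, add_comm]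
  · filter_upwards [hsplit hxy hy.le] with s hs
    simp [stableLevyMotion, hx.not_ge, hy.not_ge, hs]

variable {f : ℝ → ℝ} {X : S → ℝ}

theorem exists_isStableIntegral (hM : IsSymStableRandomMeasure α P M) (hα : 0 < α)
    (hf : MemLp f (ENNReal.ofReal α) volume) : ∃ X, IsStableIntegral α P M f X := by
  have happrox (n : ℕ) : ∃ φ : SimpleFunc ℝ ℝ,
      eLpNorm (f - ⇑φ) (ENNReal.ofReal α) volume < ((n : ℝ≥0∞) + 1)⁻¹ ∧
        MemLp φ (ENNReal.ofReal α) volume :=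
    hf.exists_simpleFunc_eLpNorm_sub_lt ENNReal.ofReal_ne_top (by simp)
  choose φ hφf hφ using happrox
  have hφ0 : Tendsto (fun n => eLpNorm (f - ⇑(φ n)) (ENNReal.ofReal α) volume) atTop (𝓝 0) :=
    tendsto_of_tendsto_of_tendsto_of_le_of_le tendsto_const_nhds
      (ENNReal.tendsto_inv_nat_nhds_zero.comp (tendsto_add_atTop_nat 1)) (fun _ => zero_le)
      fun n => by simpa using (hφf n).le
  have hI (n : ℕ) : Measurable (simpleStableIntegral M (φ n)) :=
    hM.measurable_simpleStableIntegral hα (hφ n)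
  have hcauchy : TendstoInMeasure P (fun mn : ℕ × ℕ =>
      simpleStableIntegral M (φ mn.1) - simpleStableIntegral M (φ mn.2)) atTop 0 := by
    have hscale : Tendsto (fun mn : ℕ × ℕ =>
        (eLpNorm (φ mn.1 - φ mn.2 : SimpleFunc ℝ ℝ) (ENNReal.ofReal α) volume).toReal)
        atTop (𝓝 0) := by
      simpa only [Function.comp_def, SimpleFunc.coe_sub, ENNReal.toReal_zero] using
        (ENNReal.tendsto_toReal ENNReal.zero_ne_top).comp
          (tendsto_eLpNorm_sub_sub (φ := fun n => ⇑(φ n)) hf.1 (fun n => (hφ n).1) hφ0)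
    exact (HasSymStableLaw.tendstoInMeasure_zero hα (fun mn =>
      hM.hasSymStableLaw_simpleStableIntegral hα ((hφ mn.1).sub (hφ mn.2))) hscale).congr_left
      fun mn => hM.simpleStableIntegral_sub hα (hφ mn.1) (hφ mn.2)
  obtain ⟨ns, X, hns, hX, hlim⟩ :=
    exists_subseq_tendsto_ae_of_cauchy (fun n => (hI n).aemeasurable) hcauchy
  exact ⟨X, hX, fun n => φ (ns n), fun n => hφ _, hφ0.comp hns.tendsto_atTop,
    tendstoInMeasure_of_tendsto_ae (fun n => (hI _).aestronglyMeasurable) hlim⟩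

theorem isStableIntegral_stableIntegral (hM : IsSymStableRandomMeasure α P M) (hα : 0 < α)
    (hf : MemLp f (ENNReal.ofReal α) volume) :
    IsStableIntegral α P M f (stableIntegral α P M f) := by
  have h := hM.exists_isStableIntegral hα hf
  rw [stableIntegral, dif_pos h]
  exact h.choose_spec

theorem hasSymStableLaw_of_isStableIntegral (hM : IsSymStableRandomMeasure α P M) (hα : 0 < α)
    (hf : MemLp f (ENNReal.ofReal α) volume) (hX : IsStableIntegral α P M f X) :
    HasSymStableLaw α (eLpNorm f (ENNReal.ofReal α) volume).toReal P X := by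
  obtain ⟨-, φ, hφ, hφf, hφX⟩ := hX
  exact HasSymStableLaw.of_tendstoInMeasure hα
    (fun n => hM.hasSymStableLaw_simpleStableIntegral hα (hφ n)) hφX
    ((ENNReal.tendsto_toReal hf.eLpNorm_ne_top).comp
      (tendsto_eLpNorm_of_tendsto_eLpNorm_sub hα hf (fun n => (hφ n).1) hφf))

theorem isStableIntegral_sub_simpleFunc (hM : IsSymStableRandomMeasure α P M) (hα : 0 < α)
    (hX : IsStableIntegral α P M f X) (hψ : MemLp ψ (ENNReal.ofReal α) volume) :
    IsStableIntegral α P M (f - ψ) (X - simpleStableIntegral M ψ) := by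
  obtain ⟨hXm, φ, hφ, hφf, hφX⟩ := hX
  refine ⟨hXm.sub (hM.measurable_simpleStableIntegral hα hψ), fun n => φ n - ψ,
    fun n => (hφ n).sub hψ, by simpa using hφf, ?_⟩
  have hshift : TendstoInMeasure P
      (fun n => simpleStableIntegral M (φ n) - simpleStableIntegral M ψ) atTop
      (X - simpleStableIntegral M ψ) := by
    simpa only [TendstoInMeasure, Pi.sub_apply, edist_sub_right] using hφX
  exact hshift.congr_left fun n => (hM.simpleStableIntegral_sub hα (hφ n) hψ).symm

end IsSymStableRandomMeasure

section GridStep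

/-- The cell `[(j - 1) / ω, j / ω)` of the grid of mesh `1 / ω`. -/
def gridCell (ω : ℕ) (j : ℤ) : Set ℝ :=
  Set.Ico (((j : ℝ) - 1) / ω) ((j : ℝ) / ω)

/-- The endpoint of `gridCell ω j` farther from the origin, where the Riemann sum evaluates the
kernel. -/
noncomputable def farEndpoint (ω : ℕ) (j : ℤ) : ℝ :=
  if j ≤ 0 then ((j : ℝ) - 1) / ω else (j : ℝ) / ω

/-- The step function that on each of the `2 * N` grid cells around the origin takes the value of
`g` at the far endpoint, and vanishes on the remaining cells. The paper's cut-off `Ω` corresponds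
to `N = ω * Ω`. -/
noncomputable def gridStep (g : ℝ → ℝ) (ω N : ℕ) : SimpleFunc ℝ ℝ :=
  ∑ j ∈ Finset.Icc (-(N : ℤ) + 1) N,
    (SimpleFunc.const ℝ (g (farEndpoint ω j))).restrict (gridCell ω j)

variable {g : ℝ → ℝ} {ω N : ℕ} {α : ℝ}

theorem measurableSet_gridCell (ω : ℕ) (j : ℤ) : MeasurableSet (gridCell ω j) :=
  measurableSet_Ico

theorem mem_gridCell_iff (hω : 0 < ω) {j : ℤ} {s : ℝ} :
    s ∈ gridCell ω j ↔ ⌊(ω : ℝ) * s⌋ + 1 = j := by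
  have hω' : (0 : ℝ) < ω := Nat.cast_pos.2 hω
  rw [← eq_sub_iff_add_eq, Int.floor_eq_iff, gridCell, Set.mem_Ico, div_le_iff₀ hω',
    lt_div_iff₀ hω', mul_comm s]
  push_cast
  rw [sub_add_cancel]

theorem pairwise_disjoint_gridCell (hω : 0 < ω) :
    Pairwise fun i j => Disjoint (gridCell ω i) (gridCell ω j) := fun _ _ hij =>
  Set.disjoint_left.2 fun _ hi hj =>
    hij (((mem_gridCell_iff hω).1 hi).symm.trans ((mem_gridCell_iff hω).1 hj))

theorem biUnion_gridCell (hω : 0 < ω) (N : ℕ) :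
    ⋃ j ∈ Finset.Icc (-(N : ℤ) + 1) N, gridCell ω j = Set.Ico (-((N : ℝ) / ω)) ((N : ℝ) / ω) := by
  have hω' : (0 : ℝ) < ω := Nat.cast_pos.2 hω
  ext s
  simp only [Set.mem_iUnion, mem_gridCell_iff hω, exists_prop, exists_eq_right', Finset.mem_Icc,
    add_le_add_iff_right, Int.le_floor, Set.mem_Ico]
  rw [Int.add_one_le_iff, Int.floor_lt, ← neg_div, div_le_iff₀' hω', lt_div_iff₀' hω']
  push_cast
  rfl

theorem gridStep_apply_of_mem (hω : 0 < ω) {j : ℤ} (hj : j ∈ Finset.Icc (-(N : ℤ) + 1) N) {s : ℝ}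
    (hs : s ∈ gridCell ω j) : gridStep g ω N s = g (farEndpoint ω j) := by
  rw [gridStep, simpleFunc_coe_sum, Finset.sum_apply, Finset.sum_eq_single_of_mem j hj]
  · simp [SimpleFunc.restrict_apply _ (measurableSet_gridCell ω j), hs]
  · intro i _ hij
    have hi : s ∉ gridCell ω i := Set.disjoint_left.1 (pairwise_disjoint_gridCell hω hij.symm) hs
    simp [SimpleFunc.restrict_apply _ (measurableSet_gridCell ω i), hi]

theorem gridStep_apply_of_notMem (hω : 0 < ω) {s : ℝ}
    (hs : s ∉ Set.Ico (-((N : ℝ) / ω)) ((N : ℝ) / ω)) : gridStep g ω N s = 0 := by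
  rw [gridStep, simpleFunc_coe_sum, Finset.sum_apply]
  refine Finset.sum_eq_zero fun j hj => ?_
  have hsj : s ∉ gridCell ω j := fun h =>
    hs (biUnion_gridCell hω N ▸ Set.mem_biUnion (s := {j | j ∈ Finset.Icc _ _}) hj h)
  simp [SimpleFunc.restrict_apply _ (measurableSet_gridCell ω j), hsj]

theorem memLp_gridStep {p : ℝ≥0∞} (g : ℝ → ℝ) (ω N : ℕ) : MemLp (gridStep g ω N) p volume :=
  memLp_simpleFunc_sum fun j _ =>
    memLp_const_restrict _ (measurableSet_gridCell ω j) (by simp [gridCell])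

theorem lintegral_sub_gridStep (hω : 0 < ω) :
    ∫⁻ s, ‖g s - gridStep g ω N s‖ₑ ^ α =
      (∑ j ∈ Finset.Icc (-(N : ℤ) + 1) N,
        ∫⁻ s in gridCell ω j, ‖g s - g (farEndpoint ω j)‖ₑ ^ α) +
      ∫⁻ s in (Set.Ico (-((N : ℝ) / ω)) ((N : ℝ) / ω))ᶜ, ‖g s‖ₑ ^ α := by
  rw [← lintegral_add_compl _ (measurableSet_Ico (a := -((N : ℝ) / ω)) (b := (N : ℝ) / ω))]
  congr 1
  · rw [← biUnion_gridCell hω, lintegral_biUnion_finset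
      (fun i _ j _ hij => pairwise_disjoint_gridCell hω hij)
      fun j _ => measurableSet_gridCell ω j]
    refine Finset.sum_congr rfl fun j hj => ?_
    refine setLIntegral_congr_fun (measurableSet_gridCell ω j) fun s hs => ?_
    simp only [gridStep_apply_of_mem hω hj hs]
  · refine setLIntegral_congr_fun measurableSet_Ico.compl fun s hs => ?_
    simp only [gridStep_apply_of_notMem hω hs, sub_zero]

end GridStep

theorem lintegral_compl_Ico_enorm_rpow {f : ℝ → ℝ} {α : ℝ} (hα : 0 < α)
    (hf : MemLp f (ENNReal.ofReal α) volume) {x y : ℝ} (hxy : x ≤ y) :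
    ∫⁻ s in (Set.Ico x y)ᶜ, ‖f s‖ₑ ^ α =
      ENNReal.ofReal ((∫ s in Set.Iic x, |f s| ^ α) + ∫ s in Set.Ici y, |f s| ^ α) := by
  have hint : Integrable fun s => |f s| ^ α := by
    simpa [ENNReal.toReal_ofReal hα.le] using hf.integrable_norm_rpow (by simpa using hα) (by simp)
  have hnonneg (s : ℝ) : 0 ≤ |f s| ^ α := Real.rpow_nonneg (abs_nonneg _) α
  have hpow (s : ℝ) : ‖f s‖ₑ ^ α = ENNReal.ofReal (|f s| ^ α) := by
    rw [← ofReal_norm, ENNReal.ofReal_rpow_of_nonneg (norm_nonneg _) hα.le, Real.norm_eq_abs]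
  rw [ENNReal.ofReal_add (integral_nonneg hnonneg) (integral_nonneg hnonneg),
    ofReal_integral_eq_lintegral_ofReal hint.integrableOn (ae_of_all _ hnonneg),
    ofReal_integral_eq_lintegral_ofReal hint.integrableOn (ae_of_all _ hnonneg),
    ← setLIntegral_congr Iio_ae_eq_Iic,
    ← lintegral_union measurableSet_Ici (Set.Iio_disjoint_Ici hxy)]
  simp only [hpow]
  congr 2
  ext s
  simp only [Set.mem_compl_iff, Set.mem_Ico, not_and_or, not_le, not_lt, Set.mem_union,
    Set.mem_Iio, Set.mem_Ici]

theorem setLIntegral_Ico_abs_sub_rpow {x δ p u K : ℝ} (hδ : 0 ≤ δ) (hp : -1 < p) (hK : 0 ≤ K)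
    (hu : u = x ∨ u = x + δ) :
    ∫⁻ s in Set.Ico x (x + δ), ENNReal.ofReal (K * |s - u| ^ p) =
      ENNReal.ofReal (K * (δ ^ (p + 1) / (p + 1))) := by
  have habs : Set.EqOn (fun s : ℝ => |s| ^ p) (fun s => s ^ p) (Set.uIcc 0 δ) := fun s hs => by
    rw [Set.uIcc_of_le hδ] at hs
    simp only [abs_of_nonneg hs.1]
  have hint : IntervalIntegrable (fun s : ℝ => |s| ^ p) volume 0 δ :=
    (intervalIntegral.intervalIntegrable_rpow' hp).congr (habs.symm.mono Set.uIoc_subset_uIcc)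
  have hval : ∫ s in 0..δ, |s| ^ p = δ ^ (p + 1) / (p + 1) := by
    rw [intervalIntegral.integral_congr habs, integral_rpow (Or.inl hp),
      Real.zero_rpow (by linarith), sub_zero]
  have hshift : IntervalIntegrable (fun s : ℝ => |s - u| ^ p) volume x (x + δ) ∧
      ∫ s in x..(x + δ), |s - u| ^ p = δ ^ (p + 1) / (p + 1) := by
    rcases hu with rfl | rfl
    · refine ⟨by simpa [add_comm] using hint.comp_sub_right u, ?_⟩
      rw [intervalIntegral.integral_comp_sub_right (fun s => |s| ^ p), sub_self,
        add_sub_cancel_left, hval]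
    · simp only [abs_sub_comm _ (x + δ)]
      refine ⟨by simpa using (hint.comp_sub_left (x + δ)).symm, ?_⟩
      rw [intervalIntegral.integral_comp_sub_left (fun s => |s| ^ p), sub_self,
        add_sub_cancel_left, hval]
  rw [← ofReal_integral_eq_lintegral_ofReal
      (((intervalIntegrable_iff_integrableOn_Ico_of_le (by linarith)).1 hshift.1).const_mul K)
      (ae_of_all _ fun s => by positivity),
    integral_Ico_eq_integral_Ioo, ← integral_Ioc_eq_integral_Ioo,
    ← intervalIntegral.integral_of_le (by linarith), intervalIntegral.integral_const_mul, hshift.2]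

theorem setLIntegral_Ico_enorm_sub_rpow_le {f : ℝ → ℝ} {α a x δ u L : ℝ} (hα : 0 < α)
    (haα : 0 < 1 + a * α) (hδ : 0 ≤ δ) (hL : 0 ≤ L) (hu : u = x ∨ u = x + δ)
    (hf : ∀ s ∈ Set.Ico x (x + δ), |f s - f u| ≤ L * |s - u| ^ a) :
    ∫⁻ s in Set.Ico x (x + δ), ‖f s - f u‖ₑ ^ α ≤
      ENNReal.ofReal (L ^ α * (δ ^ (a * α + 1) / (a * α + 1))) := by
  rw [← setLIntegral_Ico_abs_sub_rpow hδ (by linarith) (Real.rpow_nonneg hL α) hu]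
  refine setLIntegral_mono' measurableSet_Ico fun s hs => ?_
  rw [← ofReal_norm, ENNReal.ofReal_rpow_of_nonneg (norm_nonneg _) hα.le, Real.norm_eq_abs,
    Real.rpow_mul (abs_nonneg _), ← Real.mul_rpow hL (Real.rpow_nonneg (abs_nonneg _) a)]
  exact ENNReal.ofReal_le_ofReal (Real.rpow_le_rpow (abs_nonneg _) (hf s hs) hα.le)

theorem sum_Icc_neg_add_one {β : Type*} [AddCommMonoid β] (N : ℕ) (f : ℤ → β) :
    ∑ j ∈ Finset.Icc (-(N : ℤ) + 1) N, f j =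
      (∑ j ∈ Finset.Icc (-(N : ℤ) + 1) 0, f j) + ∑ j ∈ Finset.Icc (1 : ℤ) N, f j := by
  rw [← Finset.sum_union (Finset.disjoint_left.2 fun j h₁ h₂ => by
    rw [Finset.mem_Icc] at h₁ h₂
    omega)]
  congr 1
  ext j
  simp only [Finset.mem_union, Finset.mem_Icc]
  omega

theorem sum_Icc_neg_add_one_eq_sum_pairs {β : Type*} [AddCommMonoid β] (N : ℕ) (f : ℤ → β) :
    ∑ j ∈ Finset.Icc (-(N : ℤ) + 1) N, f j = ∑ m ∈ Finset.Icc 1 N, (f (1 - m) + f m) := by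
  rw [sum_Icc_neg_add_one, Finset.sum_add_distrib]
  congr 1
  · refine (Finset.sum_nbij' (fun m : ℕ => 1 - (m : ℤ)) (fun j => (1 - j).toNat)
      ?_ ?_ ?_ ?_ fun _ _ => rfl).symm <;> intro i hi <;> rw [Finset.mem_Icc] at * <;> omega
  · refine (Finset.sum_nbij' (fun m : ℕ => (m : ℤ)) (fun j => j.toNat)
      ?_ ?_ ?_ ?_ fun _ _ => rfl).symm <;> intro i hi <;> rw [Finset.mem_Icc] at * <;> omega

section ErrorBound

variable {g : ℝ → ℝ} {α γ a c η : ℝ} {ω : ℕ}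

theorem setLIntegral_gridCell_enorm_sub_le (hα : 0 < α) (haα : 0 < 1 + a * α) (hc : 0 ≤ c)
    (hinc : ∀ u h : ℝ, u ≠ 0 → |h| < η → |g (u + h) - g u| ≤ c * |h| ^ a * |u| ^ (γ - a))
    (hω : 0 < ω) (hωη : 1 / (ω : ℝ) < η) {j : ℤ} {m : ℕ} (hm : 0 < m)
    (hj : |farEndpoint ω j| = m / ω) :
    ∫⁻ s in gridCell ω j, ‖g s - g (farEndpoint ω j)‖ₑ ^ α ≤
      ENNReal.ofReal (c ^ α / ((1 + a * α) * (ω : ℝ) ^ (1 + γ * α)) *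
        (1 / (m : ℝ) ^ ((a - γ) * α))) := by
  have hω' : (0 : ℝ) < ω := Nat.cast_pos.2 hω
  have hm' : (0 : ℝ) < m := Nat.cast_pos.2 hm
  have hright : ((j : ℝ) - 1) / ω + 1 / ω = j / ω := by ring
  have hend : farEndpoint ω j = ((j : ℝ) - 1) / ω ∨
      farEndpoint ω j = ((j : ℝ) - 1) / ω + 1 / ω := by
    rw [hright, farEndpoint]
    split_ifs <;> simp
  set u := farEndpoint ω j
  have hu0 : u ≠ 0 := abs_pos.1 (hj ▸ div_pos hm' hω')
  have hholder : ∀ s ∈ Set.Ico (((j : ℝ) - 1) / ω) (((j : ℝ) - 1) / ω + 1 / ω),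
      |g s - g u| ≤ c * |u| ^ (γ - a) * |s - u| ^ a := fun s hs => by
    have hsu : |s - u| ≤ 1 / ω := by
      rw [abs_le]
      rcases hend with h | h <;> constructor <;> linarith [hs.1, hs.2]
    have h := hinc u (s - u) hu0 (hsu.trans_lt hωη)
    rwa [add_sub_cancel, mul_right_comm] at h
  have hle := setLIntegral_Ico_enorm_sub_rpow_le hα haα (by positivity) (by positivity) hend hholder
  rw [hright] at hle
  refine hle.trans_eq (congrArg ENNReal.ofReal ?_)
  have hωpow : (ω : ℝ) ^ (a * α + 1) = ω ^ (1 + γ * α) * ω ^ ((a - γ) * α) := by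
    rw [← Real.rpow_add hω']
    ring_nf
  rw [Real.mul_rpow hc (by positivity), ← Real.rpow_mul (abs_nonneg u), hj,
    Real.div_rpow hm'.le hω'.le, Real.div_rpow zero_le_one hω'.le, Real.one_rpow,
    show (γ - a) * α = -((a - γ) * α) by ring, Real.rpow_neg hm'.le, Real.rpow_neg hω'.le, hωpow,
    add_comm (a * α)]
  field_simp

theorem sum_setLIntegral_gridCell_le (hα : 0 < α) (haα : 0 < 1 + a * α) (hc : 0 ≤ c)
    (hinc : ∀ u h : ℝ, u ≠ 0 → |h| < η → |g (u + h) - g u| ≤ c * |h| ^ a * |u| ^ (γ - a))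
    (hω : 0 < ω) (hωη : 1 / (ω : ℝ) < η) (N : ℕ) :
    ∑ j ∈ Finset.Icc (-(N : ℤ) + 1) N,
        ∫⁻ s in gridCell ω j, ‖g s - g (farEndpoint ω j)‖ₑ ^ α ≤
      ENNReal.ofReal (2 * c ^ α / ((1 + a * α) * (ω : ℝ) ^ (1 + γ * α)) *
        ∑ m ∈ Finset.Icc 1 N, 1 / (m : ℝ) ^ ((a - γ) * α)) := by
  have hterm (m : ℕ) : 0 ≤ c ^ α / ((1 + a * α) * (ω : ℝ) ^ (1 + γ * α)) *
      (1 / (m : ℝ) ^ ((a - γ) * α)) := by positivity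
  rw [sum_Icc_neg_add_one_eq_sum_pairs, Finset.mul_sum,
    ENNReal.ofReal_sum_of_nonneg fun m _ => by positivity]
  refine Finset.sum_le_sum fun m hm => ?_
  have hm : 0 < m := (Finset.mem_Icc.1 hm).1
  have hleft : |farEndpoint ω (1 - m)| = m / ω := by
    rw [farEndpoint, if_pos (by omega), Int.cast_sub, Int.cast_one, Int.cast_natCast,
      sub_sub_cancel_left, neg_div, abs_neg, abs_of_nonneg (by positivity)]
  have hright : |farEndpoint ω m| = m / ω := by
    rw [farEndpoint, if_neg (by omega), Int.cast_natCast, abs_of_nonneg (by positivity)]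
  rw [mul_div_assoc, mul_assoc, two_mul, ENNReal.ofReal_add (hterm m) (hterm m)]
  exact add_le_add
    (setLIntegral_gridCell_enorm_sub_le hα haα hc hinc hω hωη hm hleft)
    (setLIntegral_gridCell_enorm_sub_le hα haα hc hinc hω hωη hm hright)

theorem errorBound_nonneg (haα : 0 < 1 + a * α) (hc : 0 ≤ c) (g : ℝ → ℝ) (γ : ℝ) (ω Ω : ℕ) :
    0 ≤ errorBound α g γ a c ω Ω := by
  have hint (D : Set ℝ) : 0 ≤ ∫ s in D, |g s| ^ α := integral_nonneg fun s => by positivity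
  exact add_nonneg (add_nonneg (by positivity) (hint _)) (hint _)

theorem eLpNorm_sub_gridStep_le (hα : 0 < α) (haα : 0 < 1 + a * α) (hc : 0 ≤ c)
    (hg : MemLp g (ENNReal.ofReal α) volume)
    (hinc : ∀ u h : ℝ, u ≠ 0 → |h| < η → |g (u + h) - g u| ≤ c * |h| ^ a * |u| ^ (γ - a))
    (hω : 0 < ω) (hωη : 1 / (ω : ℝ) < η) (Ω : ℕ) :
    eLpNorm (g - ⇑(gridStep g ω (ω * Ω))) (ENNReal.ofReal α) volume ≤
      ENNReal.ofReal (errorBound α g γ a c ω Ω ^ (1 / α)) := by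
  have hcut : ((ω * Ω : ℕ) : ℝ) / ω = Ω := by
    rw [Nat.cast_mul, mul_div_cancel_left₀ _ (Nat.cast_ne_zero.2 hω.ne')]
  rw [one_div, ← ENNReal.ofReal_rpow_of_nonneg (errorBound_nonneg haα hc g γ ω Ω)
    (inv_nonneg.2 hα.le), ENNReal.le_rpow_inv_iff hα, eLpNorm_ofReal_rpow hα]
  simp only [Pi.sub_apply]
  rw [lintegral_sub_gridStep hω, hcut, lintegral_compl_Ico_enorm_rpow hα hg
    (neg_le_self (Nat.cast_nonneg Ω)), errorBound, add_assoc, ENNReal.ofReal_add (by positivity)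
      (add_nonneg (integral_nonneg fun s => by positivity)
        (integral_nonneg fun s => by positivity))]
  gcongr
  exact sum_setLIntegral_gridCell_le hα haα hc hinc hω hωη (ω * Ω)

end ErrorBound

theorem gridStep_comp_sub_left (g : ℝ → ℝ) (ω N : ℕ) (t : ℝ) :
    (gridStep g ω N).comp (fun x => t - x) (measurable_const_sub t) =
      ∑ j ∈ Finset.Icc (-(N : ℤ) + 1) N, (SimpleFunc.const ℝ (g (farEndpoint ω j))).restrict
        (Set.Ioc (t - (j : ℝ) / ω) (t - ((j : ℝ) - 1) / ω)) := by
  ext x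
  simp only [gridStep, SimpleFunc.coe_comp, simpleFunc_coe_sum, Function.comp_apply,
    Finset.sum_apply]
  refine Finset.sum_congr rfl fun j _ => ?_
  rw [SimpleFunc.restrict_apply _ (measurableSet_gridCell ω j),
    SimpleFunc.restrict_apply _ measurableSet_Ioc, ← Set.preimage_const_sub_Ico]
  rfl

namespace IsSymStableRandomMeasure

variable {S : Type*} [MeasurableSpace S] {P : Measure S} [IsProbabilityMeasure P] {α : ℝ}
  {M : Set ℝ → S → ℝ} {g : ℝ → ℝ} {ω : ℕ}

theorem stableIncrement_ae_eq (hM : IsSymStableRandomMeasure α P M) (hα : 0 < α) (ω : ℕ) (j : ℤ) :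
    stableIncrement M ω j =ᵐ[P] M (Set.Ioc ((j : ℝ) / ω) (((j : ℝ) + 1) / ω)) :=
  hM.stableLevyMotion_sub hα (by gcongr; linarith)

theorem movingAverageApprox_ae_eq (hM : IsSymStableRandomMeasure α P M) (hα : 0 < α)
    (g : ℝ → ℝ) (hω : 0 < ω) (Ω : ℕ) (k : ℤ) :
    movingAverageApprox M g ω Ω k =ᵐ[P] simpleStableIntegral M
      ((gridStep g ω (ω * Ω)).comp (fun x => k - x) (measurable_const_sub (k : ℝ))) := by
  have hω' : (ω : ℝ) ≠ 0 := Nat.cast_ne_zero.2 hω.ne'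
  have hcell (j : ℤ) : Set.Ioc (((ω * k - j : ℤ) : ℝ) / ω) ((((ω * k - j : ℤ) : ℝ) + 1) / ω) =
      Set.Ioc ((k : ℝ) - (j : ℝ) / ω) ((k : ℝ) - ((j : ℝ) - 1) / ω) := by
    congr 1 <;> push_cast <;> field_simp
    ring
  rw [gridStep_comp_sub_left]
  filter_upwards [hM.simpleStableIntegral_sum_const_restrict hα
      (Finset.Icc (-((ω * Ω : ℕ) : ℤ) + 1) (ω * Ω : ℕ)) (fun j => g (farEndpoint ω j))
      (A := fun j : ℤ => Set.Ioc ((k : ℝ) - (j : ℝ) / ω) ((k : ℝ) - ((j : ℝ) - 1) / ω))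
      (fun j _ => measurableSet_Ioc) (fun j _ => by simp),
    ae_all_iff.2 fun j : ℤ => hM.stableIncrement_ae_eq hα ω (ω * k - j)] with s hsum hincr
  rw [hsum, sum_Icc_neg_add_one, movingAverageApprox, ← Nat.cast_mul]
  congr 1 <;> refine Finset.sum_congr rfl fun j hj => ?_ <;> rw [Finset.mem_Icc] at hj
  · rw [hincr, hcell, farEndpoint, if_pos hj.2]
  · rw [hincr, hcell, farEndpoint, if_neg (by omega)]

theorem hasSymStableLaw_movingAverage_sub_approx (hM : IsSymStableRandomMeasure α P M)
    (hα : 0 < α) (hg : MemLp g (ENNReal.ofReal α) volume) (hω : 0 < ω) (Ω : ℕ) (k : ℤ) :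
    HasSymStableLaw α (eLpNorm (g - ⇑(gridStep g ω (ω * Ω))) (ENNReal.ofReal α) volume).toReal P
      (fun s => movingAverage α P M g k s - movingAverageApprox M g ω Ω k s) := by
  have hreflect := Measure.measurePreserving_sub_left (volume : Measure ℝ) (k : ℝ)
  have hgk := hg.comp_measurePreserving hreflect
  have hψ := memLp_gridStep (p := ENNReal.ofReal α) g ω (ω * Ω)
  have hψk : MemLp ((gridStep g ω (ω * Ω)).comp (fun x => k - x) (measurable_const_sub (k : ℝ)))
    (ENNReal.ofReal α) volume := hψ.comp_measurePreserving hreflect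
  have hint : IsStableIntegral α P M (g ∘ fun x => k - x) (movingAverage α P M g k) :=
    hM.isStableIntegral_stableIntegral hα hgk
  rw [← eLpNorm_comp_measurePreserving (hg.sub hψ).aestronglyMeasurable hreflect]
  exact (hM.hasSymStableLaw_of_isStableIntegral hα (hgk.sub hψk)
    (hM.isStableIntegral_sub_simpleFunc hα hint hψk)).congr_ae
    (EventuallyEq.rfl.sub (hM.movingAverageApprox_ae_eq hα g hω Ω k).symm)

end IsSymStableRandomMeasure

theorem proposition5p1_general {S : Type*} [MeasurableSpace S] (P : Measure S)
    [IsProbabilityMeasure P] (α : ℝ) (hα : 0 < α)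
    (M : Set ℝ → S → ℝ) (hM : IsSymStableRandomMeasure α P M)
    (g : ℝ → ℝ) (hg : MemLp g (ENNReal.ofReal α) volume)
    (γ a c η : ℝ) (hc : 0 ≤ c) (hη : 0 < η) (haα : 0 < 1 + a * α)
    (hinc : ∀ u h : ℝ, u ≠ 0 → |h| < η → |g (u + h) - g u| ≤ c * |h| ^ a * |u| ^ (γ - a))
    (ω Ω : ℕ) (k : ℤ) (hω : 1 / η < (ω : ℝ)) :
    (∃ σ : ℝ, HasSymStableLaw α σ P
      (fun s => movingAverage α P M g k s - movingAverageApprox M g ω Ω k s)) ∧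
    alphaNorm α P (fun s => movingAverage α P M g k s - movingAverageApprox M g ω Ω k s)
      ≤ errorBound α g γ a c ω Ω ^ (1 / α) := by
  have hω' : (0 : ℝ) < ω := (one_div_pos.2 hη).trans hω
  have hω₀ : 0 < ω := Nat.cast_pos.1 hω'
  have hlaw := hM.hasSymStableLaw_movingAverage_sub_approx hα hg hω₀ Ω k
  refine ⟨⟨_, hlaw⟩, ?_⟩
  rw [alphaNorm_eq hα hlaw]
  exact ENNReal.toReal_le_of_le_ofReal
    (Real.rpow_nonneg (errorBound_nonneg haα hc g γ ω Ω) _)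
    (eLpNorm_sub_gridStep_le hα haα hc hg hinc hω₀ ((one_div_lt hη hω').1 hω) Ω)

theorem proposition5p1 {S : Type*} [MeasurableSpace S] (P : Measure S) [IsProbabilityMeasure P]
    (α : ℝ) (hα : 0 < α) (hα2 : α ≤ 2)
    (M : Set ℝ → S → ℝ) (hM : IsSymStableRandomMeasure α P M)
    (g : ℝ → ℝ) (hg : MemLp g (ENNReal.ofReal α) volume)
    (c₀p c₀m γ a c η : ℝ) (hc : 0 < c) (hη : 0 < η)
    (hγ : 0 < γ + 1 / α) (hγa : γ + 1 / α < a) (ha : a ≤ 1)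
    (hgp : Tendsto (fun r : ℝ => g r / r ^ γ) (𝓝[>] 0) (𝓝 c₀p))
    (hgm : Tendsto (fun r : ℝ => g (-r) / r ^ γ) (𝓝[>] 0) (𝓝 c₀m))
    (hinc : ∀ u h : ℝ, u ≠ 0 → |h| < η → |g (u + h) - g u| ≤ c * |h| ^ a * |u| ^ (γ - a))
    (ω Ω : ℕ) (k : ℤ) (hω : 1 / η < (ω : ℝ)) :
    (∃ σ : ℝ, HasSymStableLaw α σ P
      (fun s => movingAverage α P M g k s - movingAverageApprox M g ω Ω k s)) ∧
    alphaNorm α P (fun s => movingAverage α P M g k s - movingAverageApprox M g ω Ω k s)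
      ≤ errorBound α g γ a c ω Ω ^ (1 / α) := by
  have haα : 0 < a * α := mul_pos (hγ.trans hγa) hα
  exact proposition5p1_general P α hα M hM g hg γ a c η hc.le hη (by linarith) hinc ω Ω k hω
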